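/- Let $\kappa \geq \lambda$ be infinite cardinals ($\lambda$ is not assumed to be regular). Let $\omega^\kappa$ denote the product of $\kappa$ copies of the countable discrete space $\omega$, with the Tychonoff topology. A topological space is *finally $\lambda$-compact* if every open cover has a subcover of cardinality strictly less than $\lambda$. Let $\mathcal L_{\omega_1,\omega}$ be the infinitary language which extends first-order logic (with equality, over an arbitrary vocabulary) by allowing conjunctions and disjunctions of countably many formulas, with quantification over finitely many variables. It is *$(\kappa,\lambda)$-compact* if every set $\Gamma$ of at most $\kappa$ sentences of $\mathcal L_{\omega_1,\omega}$, all of whose subsets of cardinality $<\lambda$ are satisfiable, is satisfiable. Then $\omega^\kappa$ is finally $\lambda$-compact if and only if $\mathcal L_{\omega_1,\omega}$ is $(\kappa,\lambda)$-compact. -/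

import Mathlib

open Cardinal

universe u v w

/-- A topological space `X` is finally `μ`-compact if every open cover of `X` has a subcover of
cardinality strictly less than `μ`. -/
def FinallyCompact (X : Type u) [TopologicalSpace X] (μ : Cardinal.{u}) : Prop :=
  ∀ 𝒰 : Set (Set X), (∀ U ∈ 𝒰, IsOpen U) → ⋃₀ 𝒰 = Set.univ →
    ∃ 𝒱 : Set (Set X), 𝒱 ⊆ 𝒰 ∧ #𝒱 < μ ∧ ⋃₀ 𝒱 = Set.univ

/-- The power `ω ^ κ`: functions from (the initial ordinal) `κ` into the countable discrete space
`ℕ`, with the product (Tychonoff) topology. -/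
abbrev OmegaPower (κ : Cardinal.{u}) : Type u := κ.ord.ToType → ℕ

/-- Formulas of the infinitary language `L_{ω₁,ω}` over the vocabulary `L` whose free variables
are among `x_0, …, x_{n-1}`; a quantifier in front of a formula in `n + 1` variables binds `x_n`.
Conjunctions and disjunctions range over sequences of formulas of length `ω`: finite nonempty
ones are obtained by repetition, and the empty disjunction is `falsum`.  (A formula occurring in a
sentence is in the scope of finitely many quantifiers, so it has finitely many free variables.) -/
inductive OmegaOneFormula (L : FirstOrder.Language.{u, v}) : ℕ → Type (max u v)
  | falsum {n : ℕ} : OmegaOneFormula L n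
  | equal {n : ℕ} (s t : L.Term (Fin n)) : OmegaOneFormula L n
  | rel {n k : ℕ} (R : L.Relations k) (ts : Fin k → L.Term (Fin n)) : OmegaOneFormula L n
  | neg {n : ℕ} (φ : OmegaOneFormula L n) : OmegaOneFormula L n
  | conj {n : ℕ} (φ : ℕ → OmegaOneFormula L n) : OmegaOneFormula L n
  | disj {n : ℕ} (φ : ℕ → OmegaOneFormula L n) : OmegaOneFormula L n
  | all {n : ℕ} (φ : OmegaOneFormula L (n + 1)) : OmegaOneFormula L n
  | ex {n : ℕ} (φ : OmegaOneFormula L (n + 1)) : OmegaOneFormula L n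

namespace OmegaOneFormula

/-- Truth of a formula in the `L`-structure `M` under an assignment of the free variables. -/
def Realize {L : FirstOrder.Language.{u, v}} {M : Type w} [L.Structure M] :
    {n : ℕ} → OmegaOneFormula L n → (Fin n → M) → Prop
  | _, falsum, _ => False
  | _, equal s t, a => s.realize a = t.realize a
  | _, rel R ts, a => FirstOrder.Language.Structure.RelMap R (fun i => (ts i).realize a)
  | _, neg φ, a => ¬ φ.Realize a
  | _, conj φ, a => ∀ i, (φ i).Realize a
  | _, disj φ, a => ∃ i, (φ i).Realize a
  | _, all φ, a => ∀ x : M, φ.Realize (Fin.snoc a x)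
  | _, ex φ, a => ∃ x : M, φ.Realize (Fin.snoc a x)

end OmegaOneFormula

/-- Sentences of `L_{ω₁,ω}` over the vocabulary `L`. -/
abbrev OmegaOneSentence (L : FirstOrder.Language.{u, v}) : Type (max u v) := OmegaOneFormula L 0

/-- A set of sentences of `L_{ω₁,ω}` is satisfiable if it has a (nonempty) model. -/
def OmegaOneSatisfiable {L : FirstOrder.Language.{u, u}} (Γ : Set (OmegaOneSentence L)) : Prop :=
  ∃ (M : Type u) (_ : Nonempty M) (_ : L.Structure M),
    ∀ φ ∈ Γ, OmegaOneFormula.Realize (M := M) φ Fin.elim0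

/-- `L_{ω₁,ω}` is `(ν, μ)`-compact: over every vocabulary, every set `Γ` of at most `ν` sentences
such that each subset of `Γ` of cardinality `< μ` is satisfiable is itself satisfiable. -/
def OmegaOneLogicCompact (ν μ : Cardinal.{u}) : Prop :=
  ∀ (L : FirstOrder.Language.{u, u}) (Γ : Set (OmegaOneSentence L)), #Γ ≤ ν →
    (∀ Γ' : Set (OmegaOneSentence L), Γ' ⊆ Γ → #Γ' < μ → OmegaOneSatisfiable Γ') →
    OmegaOneSatisfiable Γ

/-!
The equivalence translates between points of a power of `ω` and truth assignments.

*From the logic to the space.* An open cover of `ω ^ κ` is refined by boxes, each fixing finitely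
many coordinates; there are at most `κ` of them. With a nullary relation `P (α, n)` saying that the
coordinate `α` has the value `n`, the sentences `⋁ n, P (α, n)` together with the sentences "the
point is not in the box `b`" have a model exactly when some point is missed by the cover. So
`(κ, μ)`-compactness extracts a subcover of size `< μ` (`finallyCompact_of_omegaOneLogicCompact`).

*From the space to the logic.* A set `Γ` of at most `κ` sentences involves a set `A` of at most `κ`
formulas and function symbols (`exists_isFragment`). The well-founded trees `Name A` labelled by
these parts number at most `κ` and play two roles: the tree with root `φ` and children `a` is both
the instance `φ(a)` and a Henkin witness for that instance, when `φ` is a quantified formula. Every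
structure assigns to each instance a truth value and, for infinite conjunctions and disjunctions,
the number of a deciding member (`trace`); this is a point of `(Bool × ℕ) ^ Name A`, a continuous
image of `ω ^ κ`. A point in the closure of the set of traces agrees with some trace on any
finite set of names, and this suffices to turn the names, modulo the equality it prescribes, into a
structure whose true instances are those prescribed (`NameModel.realize_mk_iff`): the numbers and the
witnesses turn each infinitary truth condition into conditions on finitely many coordinates. That
each `γ ∈ Γ` be true is a closed condition on such points, fewer than `μ` of these conditions are
met by the trace of a model, hence by final `μ`-compactness they are met simultaneously. As the
closure is taken over all structures, only the sentences in `Γ` have to be counted, and regularity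
of `μ` plays no role.
-/

/-! ### Final compactness -/

/-- Continuous images of finally `μ`-compact spaces are finally `μ`-compact. -/
theorem FinallyCompact.of_surjective {X Y : Type u} [TopologicalSpace X] [TopologicalSpace Y]
    {μ : Cardinal.{u}} (hX : FinallyCompact X μ) {f : X → Y} (hf : Continuous f)
    (hs : Function.Surjective f) : FinallyCompact Y μ := by
  intro 𝒰 ho hc
  obtain ⟨𝒱, h𝒱, hcard, hcov⟩ := hX ((fun U => f ⁻¹' U) '' 𝒰)
    (by rintro _ ⟨U, hU, rfl⟩; exact (ho U hU).preimage hf)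
    (by
      refine Set.eq_univ_of_forall fun x => ?_
      obtain ⟨U, hU, hx⟩ := Set.mem_sUnion.1 (hc.symm ▸ Set.mem_univ (f x) : f x ∈ ⋃₀ 𝒰)
      exact ⟨_, ⟨U, hU, rfl⟩, hx⟩)
  choose g hg hg' using fun V : 𝒱 => h𝒱 V.2
  refine ⟨Set.range g, ?_, mk_range_le.trans_lt hcard, Set.eq_univ_of_forall fun y => ?_⟩
  · rintro _ ⟨V, rfl⟩
    exact hg V
  · obtain ⟨x, rfl⟩ := hs y
    obtain ⟨V, hV, hx⟩ := Set.mem_sUnion.1 (hcov.symm ▸ Set.mem_univ x : x ∈ ⋃₀ 𝒱)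
    refine ⟨g ⟨V, hV⟩, ⟨_, rfl⟩, ?_⟩
    have h : f ⁻¹' g ⟨V, hV⟩ = V := hg' ⟨V, hV⟩
    rw [← h] at hx
    exact hx

theorem FinallyCompact.iInter_nonempty {X ι : Type u} [TopologicalSpace X] {μ : Cardinal.{u}}
    (hX : FinallyCompact X μ) (C : ι → Set X) (hC : ∀ i, IsClosed (C i))
    (h : ∀ J : Set ι, #J < μ → (⋂ j ∈ J, C j).Nonempty) : (⋂ i, C i).Nonempty := by
  by_contra hne
  rw [Set.not_nonempty_iff_eq_empty] at hne
  obtain ⟨𝒱, h𝒱, hcard, hcov⟩ := hX (Set.range fun i => (C i)ᶜ)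
    (by rintro _ ⟨i, rfl⟩; exact (hC i).isOpen_compl)
    (by rw [Set.sUnion_range, ← Set.compl_iInter, hne, Set.compl_empty])
  choose g hg using fun V : 𝒱 => h𝒱 V.2
  obtain ⟨x, hx⟩ := h (Set.range g) (mk_range_le.trans_lt hcard)
  obtain ⟨V, hV, hxV⟩ := Set.mem_sUnion.1 (hcov.symm ▸ Set.mem_univ x : x ∈ ⋃₀ 𝒱)
  have h1 : (C (g ⟨V, hV⟩))ᶜ = V := hg ⟨V, hV⟩
  rw [← h1] at hxV
  exact hxV (Set.mem_iInter₂.1 hx _ ⟨_, rfl⟩)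

/-- If `ω ^ κ` is finally `μ`-compact, then so is every power of a countable discrete space with at
most `κ` factors. -/
theorem FinallyCompact.pi_of_omegaPower {κ μ : Cardinal.{u}}
    (h : FinallyCompact (OmegaPower κ) μ) {I : Type u} (hI : #I ≤ κ) (D : Type) [Countable D]
    [Nonempty D] [TopologicalSpace D] [DiscreteTopology D] : FinallyCompact (I → D) μ := by
  obtain ⟨e⟩ : Nonempty (I ↪ κ.ord.ToType) := by
    rw [← Cardinal.le_def, Cardinal.mk_ord_toType]
    exact hI
  obtain ⟨d, hd⟩ := exists_surjective_nat D
  refine h.of_surjective (f := fun x i => d (x (e i)))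
    (continuous_pi fun i => continuous_of_discreteTopology.comp (continuous_apply (e i))) ?_
  intro y
  choose r hr using hd
  refine ⟨Function.extend e (fun i => r (y i)) 0, funext fun i => ?_⟩
  change d (Function.extend e (fun i => r (y i)) 0 (e i)) = y i
  rw [e.injective.extend_apply, hr]

/-! ### From the logic to the space -/

namespace OmegaOneFormula

/-- The disjunction of a finite list of formulas, padded by `falsum` to length `ω`. -/
def listDisj {L : FirstOrder.Language.{u, v}} {n : ℕ} (l : List (OmegaOneFormula L n)) :
    OmegaOneFormula L n :=
  disj fun i => l.getD i falsum

theorem realize_listDisj {L : FirstOrder.Language.{u, v}} {M : Type w} [L.Structure M] {n : ℕ}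
    (l : List (OmegaOneFormula L n)) (a : Fin n → M) :
    (listDisj l).Realize a ↔ ∃ φ ∈ l, φ.Realize a := by
  simp only [listDisj, Realize]
  constructor
  · rintro ⟨i, hi⟩
    by_cases h : i < l.length
    · rw [List.getD_eq_getElem _ _ h] at hi
      exact ⟨_, List.getElem_mem h, hi⟩
    · rw [List.getD_eq_default _ _ (not_lt.1 h)] at hi
      exact hi.elim
  · rintro ⟨φ, hφ, h⟩
    obtain ⟨i, hi, rfl⟩ := List.getElem_of_mem hφ
    exact ⟨i, by rwa [List.getD_eq_getElem _ _ hi]⟩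

end OmegaOneFormula

/-- The vocabulary describing a point of `ω ^ K`; the nullary relation `(α, n)` says that the
coordinate `α` has the value `n`. (Relation symbols of positive arity are never used.) -/
def pointLanguage (K : Type u) : FirstOrder.Language.{u, u} where
  Functions _ := PEmpty
  Relations _ := K × ℕ

namespace pointLanguage

variable {K : Type u}

/-- The one-element structure describing the point `x`. -/
abbrev pointStructure (x : K → ℕ) : (pointLanguage K).Structure PUnit.{u + 1} where
  funMap f _ := PEmpty.elim f
  RelMap R _ := x (R : K × ℕ).1 = (R : K × ℕ).2

/-- The sentence saying that the coordinate `p.1` has the value `p.2`. -/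
def atom (p : K × ℕ) : OmegaOneSentence (pointLanguage K) :=
  .rel (k := 0) p Fin.elim0

/-- The sentence saying that the coordinate `α` has some value. -/
def total (α : K) : OmegaOneSentence (pointLanguage K) :=
  .disj fun n => atom (α, n)

/-- The sentence saying that the point lies outside the box `{x | ∀ p ∈ b, x p.1 = p.2}`. -/
noncomputable def avoid (b : Finset (K × ℕ)) : OmegaOneSentence (pointLanguage K) :=
  .listDisj (b.toList.map fun p => (atom p).neg)

theorem realize_avoid {M : Type w} [(pointLanguage K).Structure M] (b : Finset (K × ℕ))
    (a : Fin 0 → M) : (avoid b).Realize a ↔ ∃ p ∈ b, ¬ (atom p).Realize a := by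
  simp [avoid, OmegaOneFormula.realize_listDisj, OmegaOneFormula.Realize]

end pointLanguage

open pointLanguage in
theorem finallyCompact_of_omegaOneLogicCompact {κ μ : Cardinal.{u}} (hκ : ℵ₀ ≤ κ)
    (h : OmegaOneLogicCompact κ μ) : FinallyCompact (OmegaPower κ) μ := by
  intro 𝒰 ho hc
  by_contra hno
  let K := κ.ord.ToType
  have hK : #K = κ := Cardinal.mk_ord_toType κ
  have : Infinite K := Cardinal.infinite_iff.2 (hK.symm ▸ hκ)
  -- The boxes contained in a member of the cover.
  let B : Set (Finset (K × ℕ)) := {b | ∃ U ∈ 𝒰, {x : K → ℕ | ∀ p ∈ b, x p.1 = p.2} ⊆ U}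
  let Γ : Set (OmegaOneSentence (pointLanguage K)) := Set.range total ∪ avoid '' B
  have hΓ : #Γ ≤ κ := by
    refine (mk_union_le _ _).trans (add_le_of_le hκ (mk_range_le.trans hK.le) ?_)
    refine mk_image_le.trans ((mk_set_le B).trans ?_)
    rw [mk_finset_of_infinite, mk_prod, lift_uzero, mk_nat, lift_aleph0, hK]
    exact mul_le_of_le hκ le_rfl hκ
  obtain ⟨U₀, hU₀, -⟩ := Set.mem_sUnion.1 (hc.symm ▸ Set.mem_univ 0 : (0 : K → ℕ) ∈ ⋃₀ 𝒰)
  have key : ∀ γ : Γ, ∃ U ∈ 𝒰, ∀ x ∉ U,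
      @OmegaOneFormula.Realize _ PUnit.{u + 1} (pointStructure x) _ γ.1 Fin.elim0 := by
    rintro ⟨_, ⟨α, rfl⟩ | ⟨b, ⟨U, hU, hb⟩, rfl⟩⟩
    · exact ⟨U₀, hU₀, fun x _ => ⟨x α, rfl⟩⟩
    · refine ⟨U, hU, fun x hx => ?_⟩
      let := pointStructure x
      by_contra hr
      rw [realize_avoid] at hr
      push Not at hr
      exact hx (hb fun p hp => hr p hp)
  choose g hg hg' using key
  obtain ⟨M, hM, _, hsat⟩ := h _ Γ hΓ fun Γ' hΓ' hcard => by
    have hV : ⋃₀ (Set.range fun γ : Γ' => g ⟨γ.1, hΓ' γ.2⟩) ≠ Set.univ := fun hcov =>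
      hno ⟨_, by rintro _ ⟨γ, rfl⟩; exact hg _, mk_range_le.trans_lt hcard, hcov⟩
    obtain ⟨x, hx⟩ := (Set.ne_univ_iff_exists_notMem _).1 hV
    exact ⟨PUnit, inferInstance, pointStructure x, fun φ hφ =>
      hg' ⟨φ, hΓ' hφ⟩ x fun hxU => hx ⟨_, ⟨⟨φ, hφ⟩, rfl⟩, hxU⟩⟩
  -- A model of `Γ` need not determine the values uniquely, but any choice of values will do.
  have hx : ∀ α : K, ∃ n : ℕ, (atom (α, n)).Realize (Fin.elim0 : Fin 0 → M) := fun α =>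
    hsat (total α) (Or.inl ⟨α, rfl⟩)
  choose x hx using hx
  obtain ⟨U, hU, hxU⟩ := Set.mem_sUnion.1 (hc.symm ▸ Set.mem_univ x : x ∈ ⋃₀ 𝒰)
  obtain ⟨I, u, hu, hIu⟩ := isOpen_pi_iff.1 (ho U hU) x hxU
  have hb : I.image (fun i => (i, x i)) ∈ B := by
    refine ⟨U, hU, fun y hy => hIu fun i hi => ?_⟩
    have : y i = x i := hy (i, x i) (Finset.mem_image_of_mem _ hi)
    rw [this]
    exact (hu i hi).2
  obtain ⟨p, hp, hpx⟩ := (realize_avoid _ _).1 (hsat _ (Or.inr ⟨_, hb, rfl⟩))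
  obtain ⟨i, -, rfl⟩ := Finset.mem_image.1 hp
  exact hpx (hx i)

/-! ### Fragments -/

/-- The material from which names are built: a formula in `n` free variables or an `n`-ary function
symbol, for some `n`. -/
abbrev FragmentPart (L : FirstOrder.Language.{u, u}) : Type u :=
  Σ n, OmegaOneFormula L n ⊕ L.Functions n

variable {L : FirstOrder.Language.{u, u}}

/-- The function symbols occurring in a term. -/
def FirstOrder.Language.Term.functionParts {α : Type} : L.Term α → Set (FragmentPart L)
  | .var _ => ∅
  | @FirstOrder.Language.Term.func _ _ k f ts => insert ⟨k, .inr f⟩ (⋃ i, (ts i).functionParts)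

theorem FirstOrder.Language.Term.countable_functionParts {α : Type} (t : L.Term α) :
    t.functionParts.Countable := by
  induction t with
  | var _ => exact Set.countable_empty
  | func f ts ih => exact (Set.countable_iUnion ih).insert _

theorem FirstOrder.Language.Term.inl_notMem_functionParts {α : Type} (t : L.Term α) {n : ℕ}
    (φ : OmegaOneFormula L n) : (⟨n, .inl φ⟩ : FragmentPart L) ∉ t.functionParts := by
  induction t with
  | var _ => exact id
  | func f ts ih =>
    rintro (h | h)
    · obtain ⟨rfl, h⟩ := Sigma.mk.inj_iff.1 h
      cases eq_of_heq h
    · obtain ⟨i, hi⟩ := Set.mem_iUnion.1 h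
      exact ih i hi

namespace OmegaOneFormula

/-- The subformulas and the function symbols of a formula. -/
def parts : {n : ℕ} → OmegaOneFormula L n → Set (FragmentPart L)
  | n, falsum => {⟨n, .inl falsum⟩}
  | n, equal s t => insert ⟨n, .inl (equal s t)⟩ (s.functionParts ∪ t.functionParts)
  | n, rel R ts => insert ⟨n, .inl (rel R ts)⟩ (⋃ i, (ts i).functionParts)
  | n, neg φ => insert ⟨n, .inl (neg φ)⟩ φ.parts
  | n, conj φ => insert ⟨n, .inl (conj φ)⟩ (⋃ i, (φ i).parts)
  | n, disj φ => insert ⟨n, .inl (disj φ)⟩ (⋃ i, (φ i).parts)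
  | n, all φ => insert ⟨n, .inl (all φ)⟩ φ.parts
  | n, ex φ => insert ⟨n, .inl (ex φ)⟩ φ.parts

theorem countable_parts {n : ℕ} (φ : OmegaOneFormula L n) : φ.parts.Countable := by
  induction φ with
  | falsum => exact Set.countable_singleton _
  | equal s t => exact (s.countable_functionParts.union t.countable_functionParts).insert _
  | rel R ts => exact (Set.countable_iUnion fun i => (ts i).countable_functionParts).insert _
  | conj φ ih | disj φ ih => exact (Set.countable_iUnion ih).insert _
  | neg φ ih | all φ ih | ex φ ih => exact ih.insert _

theorem self_mem_parts {n : ℕ} (φ : OmegaOneFormula L n) : ⟨n, .inl φ⟩ ∈ φ.parts := by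
  cases φ <;> simp [parts]

theorem parts_subset_of_mem {m n : ℕ} {ψ : OmegaOneFormula L m} {φ : OmegaOneFormula L n}
    (h : ⟨m, .inl ψ⟩ ∈ φ.parts) : ψ.parts ⊆ φ.parts := by
  have self : ∀ {n : ℕ} {φ : OmegaOneFormula L n},
      (⟨m, .inl ψ⟩ : FragmentPart L) = ⟨n, .inl φ⟩ → ψ.parts ⊆ φ.parts := by
    intro n φ h
    obtain ⟨rfl, h⟩ := Sigma.mk.inj_iff.1 h
    cases eq_of_heq h
    exact subset_rfl
  induction φ with
  | falsum => exact self h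
  | equal s t =>
    rcases h with h | h | h
    · exact self h
    · exact (s.inl_notMem_functionParts _ h).elim
    · exact (t.inl_notMem_functionParts _ h).elim
  | rel R ts =>
    rcases h with h | h
    · exact self h
    · obtain ⟨i, hi⟩ := Set.mem_iUnion.1 h
      exact ((ts i).inl_notMem_functionParts _ hi).elim
  | conj φ ih | disj φ ih =>
    rcases h with h | h
    · exact self h
    · obtain ⟨i, hi⟩ := Set.mem_iUnion.1 h
      exact ((ih i hi).trans (Set.subset_iUnion (fun i => (φ i).parts) i)).trans
        (Set.subset_insert _ _)
  | neg φ ih | all φ ih | ex φ ih =>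
    rcases h with h | h
    · exact self h
    · exact (ih h).trans (Set.subset_insert _ _)

/-- The formula `x₀ = x₁`. -/
def eqVars : OmegaOneFormula L 2 := equal (.var 0) (.var 1)

end OmegaOneFormula

open OmegaOneFormula

/-- A fragment: a set of formulas and function symbols containing all parts of its formulas, the
formula `x₀ = x₁`, and a sentence. -/
structure IsFragment (A : Set (FragmentPart L)) : Prop where
  parts_subset : ∀ {n : ℕ} {φ : OmegaOneFormula L n}, ⟨n, .inl φ⟩ ∈ A → φ.parts ⊆ A
  eqVars_mem : ⟨2, .inl eqVars⟩ ∈ A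
  exists_sentence : ∃ φ : OmegaOneSentence L, ⟨0, .inl φ⟩ ∈ A

theorem exists_isFragment {κ : Cardinal.{u}} (hκ : ℵ₀ ≤ κ) (Γ : Set (OmegaOneSentence L))
    (hΓ : #Γ ≤ κ) :
    ∃ A : Set (FragmentPart L), IsFragment A ∧ #A ≤ κ ∧ ∀ γ ∈ Γ, ⟨0, .inl γ⟩ ∈ A := by
  let Δ : Set (OmegaOneSentence L) := insert (ex (ex eqVars)) Γ
  have hΔ : #Δ ≤ κ := mk_insert_le.trans (add_le_of_le hκ hΓ (one_le_aleph0.trans hκ))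
  have hmem : ∀ γ ∈ Δ, γ.parts ⊆ ⋃ δ : Δ, δ.1.parts := fun γ hγ =>
    Set.subset_iUnion (fun δ : Δ => δ.1.parts) ⟨γ, hγ⟩
  refine ⟨⋃ δ : Δ, δ.1.parts, ⟨fun h => ?_, ?_, ⟨ex (ex eqVars), ?_⟩⟩, ?_, fun γ hγ => ?_⟩
  · obtain ⟨δ, hδ⟩ := Set.mem_iUnion.1 h
    exact (parts_subset_of_mem hδ).trans (hmem _ δ.2)
  · exact hmem _ (Set.mem_insert _ _) (Or.inr (Or.inr (self_mem_parts _)))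
  · exact hmem _ (Set.mem_insert _ _) (self_mem_parts _)
  · refine (mk_iUnion_le _).trans (mul_le_of_le hκ hΔ ?_)
    exact (ciSup_le' fun δ : Δ => (countable_parts δ.1).le_aleph0).trans hκ
  · exact hmem _ (Set.mem_insert_of_mem _ hγ) (self_mem_parts _)

namespace IsFragment

variable {A : Set (FragmentPart L)} {n : ℕ}

theorem functionParts_left (hA : IsFragment A) {s t : L.Term (Fin n)}
    (h : ⟨n, .inl (equal s t)⟩ ∈ A) : s.functionParts ⊆ A := fun _ hp =>
  hA.parts_subset h (Or.inr (Or.inl hp))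

theorem functionParts_right (hA : IsFragment A) {s t : L.Term (Fin n)}
    (h : ⟨n, .inl (equal s t)⟩ ∈ A) : t.functionParts ⊆ A := fun _ hp =>
  hA.parts_subset h (Or.inr (Or.inr hp))

theorem functionParts_rel (hA : IsFragment A) {k : ℕ} {R : L.Relations k}
    {ts : Fin k → L.Term (Fin n)} (h : ⟨n, .inl (rel R ts)⟩ ∈ A) (i : Fin k) :
    (ts i).functionParts ⊆ A := fun _ hp =>
  hA.parts_subset h (Or.inr (Set.mem_iUnion.2 ⟨i, hp⟩))

theorem neg_mem (hA : IsFragment A) {φ : OmegaOneFormula L n} (h : ⟨n, .inl (neg φ)⟩ ∈ A) :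
    ⟨n, .inl φ⟩ ∈ A :=
  hA.parts_subset h (Or.inr φ.self_mem_parts)

theorem conj_mem (hA : IsFragment A) {φ : ℕ → OmegaOneFormula L n}
    (h : ⟨n, .inl (conj φ)⟩ ∈ A) (i : ℕ) : ⟨n, .inl (φ i)⟩ ∈ A :=
  hA.parts_subset h (Or.inr (Set.mem_iUnion.2 ⟨i, (φ i).self_mem_parts⟩))

theorem disj_mem (hA : IsFragment A) {φ : ℕ → OmegaOneFormula L n}
    (h : ⟨n, .inl (disj φ)⟩ ∈ A) (i : ℕ) : ⟨n, .inl (φ i)⟩ ∈ A :=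
  hA.parts_subset h (Or.inr (Set.mem_iUnion.2 ⟨i, (φ i).self_mem_parts⟩))

theorem all_mem (hA : IsFragment A) {φ : OmegaOneFormula L (n + 1)}
    (h : ⟨n, .inl (all φ)⟩ ∈ A) : ⟨n + 1, .inl φ⟩ ∈ A :=
  hA.parts_subset h (Or.inr φ.self_mem_parts)

theorem ex_mem (hA : IsFragment A) {φ : OmegaOneFormula L (n + 1)}
    (h : ⟨n, .inl (ex φ)⟩ ∈ A) : ⟨n + 1, .inl φ⟩ ∈ A :=
  hA.parts_subset h (Or.inr φ.self_mem_parts)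

end IsFragment

/-! ### Names and their values in a structure -/

/-- Names over a set `A` of parts: closed terms in which every `n`-ary function symbol and every
formula in `n` free variables from `A` acts as an `n`-ary operation. The name with root `φ` and
arguments `a` stands for a witness for `φ(a)` when `φ` is a quantified formula, and also serves as
an index for the sentence `φ(a)` itself. -/
abbrev Name (A : Set (FragmentPart L)) : Type u := WType fun p : A => Fin p.1.1

theorem mk_name_le {κ : Cardinal.{u}} (hκ : ℵ₀ ≤ κ) {A : Set (FragmentPart L)} (hA : #A ≤ κ) :
    #(Name A) ≤ κ :=
  WType.cardinalMk_le_max_aleph0_of_finite'.trans (max_le (by simpa using hA) (by simpa using hκ))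

theorem IsFragment.nonempty_name {A : Set (FragmentPart L)} (hA : IsFragment A) :
    Nonempty (Name A) :=
  let ⟨_, hφ⟩ := hA.exists_sentence
  ⟨.mk ⟨_, hφ⟩ Fin.elim0⟩

section Values

variable (M : Type u) [Nonempty M] [L.Structure M]

/-- The operation of a structure attached to a part: function symbols act as usual, an existential
formula picks a witness, a universal formula picks a counterexample (both if there are any). The
operations of all other formulas are irrelevant. -/
noncomputable def partOp : (p : FragmentPart L) → (Fin p.1 → M) → M
  | ⟨_, .inr f⟩, a => FirstOrder.Language.Structure.funMap f a
  | ⟨_, .inl (.ex φ)⟩, a => Classical.epsilon fun y => φ.Realize (Fin.snoc a y)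
  | ⟨_, .inl (.all φ)⟩, a => Classical.epsilon fun y => ¬ φ.Realize (Fin.snoc a y)
  | ⟨_, .inl _⟩, _ => Classical.arbitrary M

variable {M} in
/-- The number of a true member of a disjunction, or of a false member of a conjunction (if there
are any). -/
noncomputable def OmegaOneFormula.memberIndex :
    {n : ℕ} → OmegaOneFormula L n → (Fin n → M) → ℕ
  | _, .conj φ, a => Classical.epsilon fun i => ¬ (φ i).Realize a
  | _, .disj φ, a => Classical.epsilon fun i => (φ i).Realize a
  | _, _, _ => 0

variable {A : Set (FragmentPart L)}

/-- The element of a structure denoted by a name. -/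
noncomputable def nameValue : Name A → M
  | .mk p a => partOp M p.1 fun i => nameValue (a i)

/-- The trace of a structure on the names: the truth value of each instance, and the number of a
member deciding it if it is an infinite conjunction or disjunction. -/
noncomputable def trace : Name A → Bool × ℕ
  | .mk ⟨⟨_, .inl φ⟩, _⟩ a =>
    open scoped Classical in
    (decide (φ.Realize fun i => nameValue M (a i)), φ.memberIndex fun i => nameValue M (a i))
  | .mk ⟨⟨_, .inr _⟩, _⟩ _ => (false, 0)

end Values

section Truth

variable {A : Set (FragmentPart L)} (v : Name A → Bool × ℕ)

/-- The instance `φ(a)` is true according to `v`. -/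
def InstanceTrue {n : ℕ} {φ : OmegaOneFormula L n} (h : ⟨n, .inl φ⟩ ∈ A) (a : Fin n → Name A) :
    Prop :=
  (v (.mk ⟨_, h⟩ a)).1 = true

/-- The names `c` and `d` are equal according to `v`. -/
def NameEq (hA : IsFragment A) (c d : Name A) : Prop := InstanceTrue v hA.eqVars_mem ![c, d]

/-- The operation of a function symbol on names; it is constant for symbols outside `A`. -/
noncomputable def nameApp (hA : IsFragment A) {k : ℕ} (f : L.Functions k) (c : Fin k → Name A) :
    Name A :=
  open scoped Classical in
  if h : ⟨k, .inr f⟩ ∈ A then .mk ⟨_, h⟩ c else hA.nonempty_name.some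

/-- The name obtained by substituting names for the variables of a term. -/
noncomputable def FirstOrder.Language.Term.toName (hA : IsFragment A) {n : ℕ}
    (a : Fin n → Name A) : L.Term (Fin n) → Name A
  | .var i => a i
  | .func f ts => nameApp hA f fun i => (ts i).toName hA a

theorem isClosed_setOf_instanceTrue {n : ℕ} {φ : OmegaOneFormula L n} (h : ⟨n, .inl φ⟩ ∈ A)
    (a : Fin n → Name A) : IsClosed {v : Name A → Bool × ℕ | InstanceTrue v h a} :=
  IsClosed.preimage (f := fun v : Name A → Bool × ℕ => v (.mk ⟨_, h⟩ a)) (continuous_apply _)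
    (isClosed_discrete {p : Bool × ℕ | p.1 = true})

variable (M : Type u) [Nonempty M] [L.Structure M]

theorem instanceTrue_trace {n : ℕ} {φ : OmegaOneFormula L n} (h : ⟨n, .inl φ⟩ ∈ A)
    (a : Fin n → Name A) :
    InstanceTrue (trace M) h a ↔ φ.Realize fun i => nameValue M (a i) := by
  simp [InstanceTrue, trace]

theorem nameEq_trace (hA : IsFragment A) (c d : Name A) :
    NameEq (trace M) hA c d ↔ nameValue M c = nameValue M d := by
  simp [NameEq, instanceTrue_trace, eqVars, Realize]

theorem nameValue_toName (hA : IsFragment A) {n : ℕ} (a : Fin n → Name A) (t : L.Term (Fin n))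
    (ht : t.functionParts ⊆ A) :
    nameValue M (t.toName hA a) = t.realize fun i => nameValue M (a i) := by
  induction t with
  | var i => rfl
  | func f ts ih =>
    have hf : ⟨_, .inr f⟩ ∈ A := ht (Set.mem_insert _ _)
    have hts : ∀ i, (ts i).functionParts ⊆ A := fun i =>
      ((Set.subset_iUnion (fun i => (ts i).functionParts) i).trans (Set.subset_insert _ _)).trans ht
    simp only [FirstOrder.Language.Term.toName, nameApp, dif_pos hf, nameValue, partOp,
      FirstOrder.Language.Term.realize_func]
    exact congrArg _ (funext fun i => ih i (hts i))

theorem nameValue_snoc {n : ℕ} (a : Fin n → Name A) (c : Name A) :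
    (fun i => nameValue M ((Fin.snoc a c : Fin (n + 1) → Name A) i)) =
      (Fin.snoc (fun i => nameValue M (a i)) (nameValue M c) : Fin (n + 1) → M) := by
  funext i
  refine Fin.lastCases ?_ (fun j => ?_) i <;> simp

end Truth

/-! ### Limits of traces -/

section Limits

variable {A : Set (FragmentPart L)}

/-- The set of the traces of all nonempty structures. -/
def traces (A : Set (FragmentPart L)) : Set (Name A → Bool × ℕ) :=
  {v | ∃ (M : Type u) (_ : Nonempty M) (_ : L.Structure M), v = trace M}

/-- Any property of traces that involves finitely many names passes to their limits. -/
theorem exists_trace_eqOn {v : Name A → Bool × ℕ} (hv : v ∈ closure (traces A))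
    (s : Set (Name A)) (hs : s.Finite) :
    ∃ (M : Type u) (_ : Nonempty M) (_ : L.Structure M), ∀ c ∈ s, v c = trace M c := by
  obtain ⟨w, hw, M, h1, h2, rfl⟩ := mem_closure_iff.1 hv (s.pi fun c => {v c})
    (isOpen_set_pi hs fun _ _ => isOpen_discrete _) fun _ _ => rfl
  exact ⟨M, h1, h2, fun c hc => (hw c hc).symm⟩

variable {v : Name A → Bool × ℕ}

theorem instanceTrue_congr {w : Name A → Bool × ℕ} {n : ℕ} {φ : OmegaOneFormula L n}
    {h : ⟨n, .inl φ⟩ ∈ A} {a : Fin n → Name A} (hvw : v (.mk ⟨_, h⟩ a) = w (.mk ⟨_, h⟩ a)) :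
    InstanceTrue v h a ↔ InstanceTrue w h a := by
  rw [InstanceTrue, InstanceTrue, hvw]

/-- The name indexing the equation of `c` and `d`. -/
def eqName (hA : IsFragment A) (c d : Name A) : Name A := .mk ⟨_, hA.eqVars_mem⟩ ![c, d]

theorem nameEq_congr {w : Name A → Bool × ℕ} {hA : IsFragment A} {c d : Name A}
    (hvw : v (eqName hA c d) = w (eqName hA c d)) : NameEq v hA c d ↔ NameEq w hA c d :=
  instanceTrue_congr hvw

theorem nameEq_equivalence (hA : IsFragment A) (hv : v ∈ closure (traces A)) :
    Equivalence (NameEq v hA) where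
  refl c := by
    obtain ⟨M, _, _, hM⟩ := exists_trace_eqOn hv {eqName hA c c} (Set.toFinite _)
    rw [nameEq_congr (hM _ rfl), nameEq_trace]
  symm {c d} := by
    obtain ⟨M, _, _, hM⟩ := exists_trace_eqOn hv {eqName hA c d, eqName hA d c} (Set.toFinite _)
    rw [nameEq_congr (hM _ (by simp)), nameEq_congr (hM (eqName hA d c) (by simp)), nameEq_trace,
      nameEq_trace]
    exact Eq.symm
  trans {c d e} := by
    obtain ⟨M, _, _, hM⟩ := exists_trace_eqOn hv {eqName hA c d, eqName hA d e, eqName hA c e}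
      (Set.toFinite _)
    rw [nameEq_congr (hM _ (by simp)), nameEq_congr (hM (eqName hA d e) (by simp)),
      nameEq_congr (hM (eqName hA c e) (by simp)), nameEq_trace, nameEq_trace, nameEq_trace]
    exact Eq.trans

theorem nameEq_nameApp (hA : IsFragment A) (hv : v ∈ closure (traces A)) {k : ℕ}
    (f : L.Functions k) {c d : Fin k → Name A} (hcd : ∀ i, NameEq v hA (c i) (d i)) :
    NameEq v hA (nameApp hA f c) (nameApp hA f d) := by
  by_cases h : ⟨k, .inr f⟩ ∈ A
  · obtain ⟨M, _, _, hM⟩ := exists_trace_eqOn hv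
      (insert (eqName hA (nameApp hA f c) (nameApp hA f d))
        (Set.range fun i => eqName hA (c i) (d i))) (Set.toFinite _)
    rw [nameEq_congr (hM _ (by simp)), nameEq_trace]
    have : ∀ i, nameValue M (c i) = nameValue M (d i) := fun i => by
      rw [← nameEq_trace M hA, ← nameEq_congr (hM _ (Or.inr ⟨i, rfl⟩))]
      exact hcd i
    simp only [nameApp, dif_pos h, nameValue, this]
  · simp only [nameApp, dif_neg h]
    exact (nameEq_equivalence hA hv).refl _

theorem instanceTrue_equal (hA : IsFragment A) (hv : v ∈ closure (traces A)) {n : ℕ}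
    {s t : L.Term (Fin n)} (h : ⟨n, .inl (equal s t)⟩ ∈ A) (a : Fin n → Name A) :
    InstanceTrue v h a ↔ NameEq v hA (s.toName hA a) (t.toName hA a) := by
  obtain ⟨M, _, _, hM⟩ := exists_trace_eqOn hv
    {.mk ⟨_, h⟩ a, eqName hA (s.toName hA a) (t.toName hA a)} (Set.toFinite _)
  rw [instanceTrue_congr (hM _ (by simp)), nameEq_congr (hM _ (by simp)), nameEq_trace,
    instanceTrue_trace, nameValue_toName M hA a s (hA.functionParts_left h),
    nameValue_toName M hA a t (hA.functionParts_right h)]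
  rfl

theorem instanceTrue_rel_of_nameEq (hA : IsFragment A) (hv : v ∈ closure (traces A))
    {m n k : ℕ} {R : L.Relations k} {ts : Fin k → L.Term (Fin m)} {us : Fin k → L.Term (Fin n)}
    (h : ⟨m, .inl (rel R ts)⟩ ∈ A) (h' : ⟨n, .inl (rel R us)⟩ ∈ A) (a : Fin m → Name A)
    (b : Fin n → Name A) (hab : ∀ i, NameEq v hA ((ts i).toName hA a) ((us i).toName hA b))
    (ht : InstanceTrue v h a) : InstanceTrue v h' b := by
  obtain ⟨M, _, _, hM⟩ := exists_trace_eqOn hv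
    (insert (.mk ⟨_, h⟩ a) (insert (.mk ⟨_, h'⟩ b)
      (Set.range fun i => eqName hA ((ts i).toName hA a) ((us i).toName hA b)))) (Set.toFinite _)
  rw [instanceTrue_congr (hM _ (by simp)), instanceTrue_trace] at ht
  rw [instanceTrue_congr (hM _ (by simp)), instanceTrue_trace]
  have : ∀ i, (ts i).realize (fun i => nameValue M (a i)) =
      (us i).realize fun i => nameValue M (b i) := fun i => by
    rw [← nameValue_toName M hA a _ (hA.functionParts_rel h i),
      ← nameValue_toName M hA b _ (hA.functionParts_rel h' i), ← nameEq_trace M hA,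
      ← nameEq_congr (hM _ (Or.inr (Or.inr ⟨i, rfl⟩)))]
    exact hab i
  simp only [Realize, this] at ht
  exact ht

theorem not_instanceTrue_falsum (hv : v ∈ closure (traces A)) {n : ℕ}
    (h : ⟨n, .inl falsum⟩ ∈ A) (a : Fin n → Name A) : ¬ InstanceTrue v h a := by
  obtain ⟨M, _, _, hM⟩ := exists_trace_eqOn hv {.mk ⟨_, h⟩ a} (Set.toFinite _)
  rw [instanceTrue_congr (hM _ rfl), instanceTrue_trace]
  exact id

theorem instanceTrue_neg (hA : IsFragment A) (hv : v ∈ closure (traces A)) {n : ℕ}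
    {φ : OmegaOneFormula L n} (h : ⟨n, .inl (neg φ)⟩ ∈ A) (a : Fin n → Name A) :
    InstanceTrue v h a ↔ ¬ InstanceTrue v (hA.neg_mem h) a := by
  obtain ⟨M, _, _, hM⟩ := exists_trace_eqOn hv {.mk ⟨_, h⟩ a, .mk ⟨_, hA.neg_mem h⟩ a}
    (Set.toFinite _)
  rw [instanceTrue_congr (hM _ (by simp)),
    instanceTrue_congr (hM (.mk ⟨_, hA.neg_mem h⟩ a) (by simp)),
    instanceTrue_trace, instanceTrue_trace]
  rfl

theorem instanceTrue_conj (hA : IsFragment A) (hv : v ∈ closure (traces A)) {n : ℕ}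
    {φ : ℕ → OmegaOneFormula L n} (h : ⟨n, .inl (conj φ)⟩ ∈ A) (a : Fin n → Name A) :
    InstanceTrue v h a ↔ ∀ i, InstanceTrue v (hA.conj_mem h i) a := by
  have key : ∀ i, ∃ (M : Type u) (_ : Nonempty M) (_ : L.Structure M),
      v (.mk ⟨_, h⟩ a) = trace M (.mk ⟨_, h⟩ a) ∧
      v (.mk ⟨_, hA.conj_mem h i⟩ a) = trace M (.mk ⟨_, hA.conj_mem h i⟩ a) := fun i => by
    obtain ⟨M, h1, h2, hM⟩ := exists_trace_eqOn hv {.mk ⟨_, h⟩ a, .mk ⟨_, hA.conj_mem h i⟩ a}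
      (Set.toFinite _)
    exact ⟨M, h1, h2, hM _ (by simp), hM _ (by simp)⟩
  constructor
  · intro ht i
    obtain ⟨M, _, _, h1, h2⟩ := key i
    rw [instanceTrue_congr h1, instanceTrue_trace] at ht
    rw [instanceTrue_congr h2, instanceTrue_trace]
    exact ht i
  · intro ht
    -- The member to look at is the one whose number is the second component of `v`.
    obtain ⟨M, _, _, h1, h2⟩ := key (v (.mk ⟨_, h⟩ a)).2
    have ht := ht (v (.mk ⟨_, h⟩ a)).2
    rw [instanceTrue_congr h2, instanceTrue_trace, h1] at ht
    rw [instanceTrue_congr h1, instanceTrue_trace]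
    by_contra hne
    obtain ⟨i, hi⟩ := not_forall.1 hne
    exact Classical.epsilon_spec (p := fun i => ¬ (φ i).Realize fun j => nameValue M (a j))
      ⟨i, hi⟩ ht

theorem instanceTrue_disj (hA : IsFragment A) (hv : v ∈ closure (traces A)) {n : ℕ}
    {φ : ℕ → OmegaOneFormula L n} (h : ⟨n, .inl (disj φ)⟩ ∈ A) (a : Fin n → Name A) :
    InstanceTrue v h a ↔ ∃ i, InstanceTrue v (hA.disj_mem h i) a := by
  have key : ∀ i, ∃ (M : Type u) (_ : Nonempty M) (_ : L.Structure M),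
      v (.mk ⟨_, h⟩ a) = trace M (.mk ⟨_, h⟩ a) ∧
      v (.mk ⟨_, hA.disj_mem h i⟩ a) = trace M (.mk ⟨_, hA.disj_mem h i⟩ a) := fun i => by
    obtain ⟨M, h1, h2, hM⟩ := exists_trace_eqOn hv {.mk ⟨_, h⟩ a, .mk ⟨_, hA.disj_mem h i⟩ a}
      (Set.toFinite _)
    exact ⟨M, h1, h2, hM _ (by simp), hM _ (by simp)⟩
  constructor
  · intro ht
    refine ⟨(v (.mk ⟨_, h⟩ a)).2, ?_⟩
    obtain ⟨M, _, _, h1, h2⟩ := key (v (.mk ⟨_, h⟩ a)).2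
    rw [instanceTrue_congr h1, instanceTrue_trace] at ht
    rw [instanceTrue_congr h2, instanceTrue_trace, h1]
    exact Classical.epsilon_spec (p := fun i => (φ i).Realize fun j => nameValue M (a j)) ht
  · rintro ⟨i, ht⟩
    obtain ⟨M, _, _, h1, h2⟩ := key i
    rw [instanceTrue_congr h2, instanceTrue_trace] at ht
    rw [instanceTrue_congr h1, instanceTrue_trace]
    exact ⟨i, ht⟩

theorem instanceTrue_all (hA : IsFragment A) (hv : v ∈ closure (traces A)) {n : ℕ}
    {φ : OmegaOneFormula L (n + 1)} (h : ⟨n, .inl (all φ)⟩ ∈ A) (a : Fin n → Name A) :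
    InstanceTrue v h a ↔ ∀ c, InstanceTrue v (hA.all_mem h) (Fin.snoc a c) := by
  have key : ∀ c, ∃ (M : Type u) (_ : Nonempty M) (_ : L.Structure M),
      v (.mk ⟨_, h⟩ a) = trace M (.mk ⟨_, h⟩ a) ∧
      v (.mk ⟨_, hA.all_mem h⟩ (Fin.snoc a c)) =
        trace M (.mk ⟨_, hA.all_mem h⟩ (Fin.snoc a c)) := fun c => by
    obtain ⟨M, h1, h2, hM⟩ := exists_trace_eqOn hv
      {.mk ⟨_, h⟩ a, .mk ⟨_, hA.all_mem h⟩ (Fin.snoc a c)} (Set.toFinite _)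
    exact ⟨M, h1, h2, hM _ (by simp), hM _ (by simp)⟩
  constructor
  · intro ht c
    obtain ⟨M, _, _, h1, h2⟩ := key c
    rw [instanceTrue_congr h1, instanceTrue_trace] at ht
    rw [instanceTrue_congr h2, instanceTrue_trace, nameValue_snoc]
    exact ht _
  · intro ht
    -- The name of the instance denotes a counterexample to it.
    obtain ⟨M, _, _, h1, h2⟩ := key (.mk ⟨_, h⟩ a)
    have ht := ht (.mk ⟨_, h⟩ a)
    rw [instanceTrue_congr h2, instanceTrue_trace, nameValue_snoc] at ht
    rw [instanceTrue_congr h1, instanceTrue_trace]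
    by_contra hne
    exact Classical.epsilon_spec
      (p := fun y => ¬ φ.Realize (Fin.snoc (fun i => nameValue M (a i)) y)) (not_forall.1 hne) ht

theorem instanceTrue_ex (hA : IsFragment A) (hv : v ∈ closure (traces A)) {n : ℕ}
    {φ : OmegaOneFormula L (n + 1)} (h : ⟨n, .inl (ex φ)⟩ ∈ A) (a : Fin n → Name A) :
    InstanceTrue v h a ↔ ∃ c, InstanceTrue v (hA.ex_mem h) (Fin.snoc a c) := by
  have key : ∀ c, ∃ (M : Type u) (_ : Nonempty M) (_ : L.Structure M),
      v (.mk ⟨_, h⟩ a) = trace M (.mk ⟨_, h⟩ a) ∧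
      v (.mk ⟨_, hA.ex_mem h⟩ (Fin.snoc a c)) =
        trace M (.mk ⟨_, hA.ex_mem h⟩ (Fin.snoc a c)) := fun c => by
    obtain ⟨M, h1, h2, hM⟩ := exists_trace_eqOn hv
      {.mk ⟨_, h⟩ a, .mk ⟨_, hA.ex_mem h⟩ (Fin.snoc a c)} (Set.toFinite _)
    exact ⟨M, h1, h2, hM _ (by simp), hM _ (by simp)⟩
  constructor
  · intro ht
    refine ⟨.mk ⟨_, h⟩ a, ?_⟩
    obtain ⟨M, _, _, h1, h2⟩ := key (.mk ⟨_, h⟩ a)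
    rw [instanceTrue_congr h1, instanceTrue_trace] at ht
    rw [instanceTrue_congr h2, instanceTrue_trace, nameValue_snoc]
    exact Classical.epsilon_spec
      (p := fun y => φ.Realize (Fin.snoc (fun i => nameValue M (a i)) y)) ht
  · rintro ⟨c, ht⟩
    obtain ⟨M, _, _, h1, h2⟩ := key c
    rw [instanceTrue_congr h2, instanceTrue_trace, nameValue_snoc] at ht
    rw [instanceTrue_congr h1, instanceTrue_trace]
    exact ⟨_, ht⟩

end Limits

/-! ### The structure of names -/

section NameModel

variable {A : Set (FragmentPart L)} {v : Name A → Bool × ℕ} (hA : IsFragment A)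
  (hv : v ∈ closure (traces A))

/-- The equality of names prescribed by a limit of traces. -/
def nameSetoid : Setoid (Name A) := ⟨NameEq v hA, nameEq_equivalence hA hv⟩

/-- Names up to the equality prescribed by a limit of traces. -/
def NameModel : Type u := Quotient (nameSetoid hA hv)

/-- The element of the model denoted by a name. -/
def NameModel.mk (c : Name A) : NameModel hA hv := Quotient.mk (nameSetoid hA hv) c

theorem NameModel.mk_eq_mk {c d : Name A} :
    NameModel.mk hA hv c = NameModel.mk hA hv d ↔ NameEq v hA c d :=
  Quotient.eq (r := nameSetoid hA hv)

theorem NameModel.mk_surjective : Function.Surjective (NameModel.mk hA hv) :=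
  Quotient.exists_rep

/-- A relation holds of a tuple if it does so according to some atomic instance in the fragment
that is about this tuple. -/
noncomputable instance : L.Structure (NameModel hA hv) where
  funMap f c :=
    NameModel.mk hA hv (nameApp hA f fun i => (NameModel.mk_surjective hA hv (c i)).choose)
  RelMap {k} R c := ∃ (n : ℕ) (ts : Fin k → L.Term (Fin n)) (h : ⟨n, .inl (rel R ts)⟩ ∈ A)
    (a : Fin n → Name A), InstanceTrue v h a ∧
      ∀ i, c i = NameModel.mk hA hv ((ts i).toName hA a)

theorem NameModel.realize_term {n : ℕ} (t : L.Term (Fin n)) (a : Fin n → Name A) :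
    t.realize (fun i => NameModel.mk hA hv (a i)) = NameModel.mk hA hv (t.toName hA a) := by
  induction t with
  | var i => rfl
  | func f ts ih =>
    rw [FirstOrder.Language.Term.realize_func]
    refine (NameModel.mk_eq_mk hA hv).2 (nameEq_nameApp hA hv f fun i => ?_)
    rw [← NameModel.mk_eq_mk hA hv, ← ih i]
    exact (NameModel.mk_surjective hA hv _).choose_spec

theorem NameModel.mk_snoc {n : ℕ} (a : Fin n → Name A) (c : Name A) :
    (Fin.snoc (fun i => NameModel.mk hA hv (a i)) (NameModel.mk hA hv c) :
      Fin (n + 1) → NameModel hA hv) =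
      fun i => NameModel.mk hA hv ((Fin.snoc a c : Fin (n + 1) → Name A) i) := by
  funext i
  refine Fin.lastCases ?_ (fun j => ?_) i <;> simp

/-- The truth lemma: the true instances in the model of names are the prescribed ones. -/
theorem NameModel.realize_mk_iff {n : ℕ} (φ : OmegaOneFormula L n) (h : ⟨n, .inl φ⟩ ∈ A)
    (a : Fin n → Name A) :
    φ.Realize (fun i => NameModel.mk hA hv (a i)) ↔ InstanceTrue v h a := by
  induction φ with
  | falsum => exact iff_of_false id (not_instanceTrue_falsum hv h a)
  | equal s t =>
    rw [instanceTrue_equal hA hv, ← NameModel.mk_eq_mk hA hv, Realize, realize_term, realize_term]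
  | rel R ts =>
    simp only [Realize, realize_term]
    constructor
    · rintro ⟨m, us, h', b, ht, hb⟩
      refine instanceTrue_rel_of_nameEq hA hv h' h b a (fun i => ?_) ht
      rw [← NameModel.mk_eq_mk hA hv]
      exact (hb i).symm
    · exact fun ht => ⟨_, ts, h, a, ht, fun _ => rfl⟩
  | neg φ ih => rw [instanceTrue_neg hA hv, Realize, ih (hA.neg_mem h)]
  | conj φ ih =>
    rw [instanceTrue_conj hA hv, Realize]
    exact forall_congr' fun i => ih i (hA.conj_mem h i) a
  | disj φ ih =>
    rw [instanceTrue_disj hA hv, Realize]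
    exact exists_congr fun i => ih i (hA.disj_mem h i) a
  | all φ ih =>
    rw [instanceTrue_all hA hv, Realize, (NameModel.mk_surjective hA hv).forall]
    exact forall_congr' fun c => by rw [mk_snoc, ih (hA.all_mem h)]
  | ex φ ih =>
    rw [instanceTrue_ex hA hv, Realize, (NameModel.mk_surjective hA hv).exists]
    exact exists_congr fun c => by rw [mk_snoc, ih (hA.ex_mem h)]

end NameModel

/-! ### From the space to the logic -/

theorem omegaOneLogicCompact_of_finallyCompact {κ μ : Cardinal.{u}} (hκ : ℵ₀ ≤ κ) (hμ : 0 < μ)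
    (h : FinallyCompact (OmegaPower κ) μ) : OmegaOneLogicCompact κ μ := by
  intro L Γ hΓ hsat
  rcases Γ.eq_empty_or_nonempty with rfl | ⟨γ₀, hγ₀⟩
  · exact hsat ∅ subset_rfl (by simpa using hμ)
  obtain ⟨A, hA, hAκ, hΓA⟩ := exists_isFragment hκ Γ hΓ
  obtain ⟨v, hv⟩ := (h.pi_of_omegaPower (mk_name_le hκ hAκ) (Bool × ℕ)).iInter_nonempty
    (fun γ : Γ => closure (traces A) ∩ {v | InstanceTrue v (hΓA γ γ.2) Fin.elim0})
    (fun γ => isClosed_closure.inter (isClosed_setOf_instanceTrue _ _))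
    fun J hJ => by
      obtain ⟨M, _, _, hM⟩ := hsat (Subtype.val '' J) (by rintro _ ⟨γ, -, rfl⟩; exact γ.2)
        (mk_image_le.trans_lt hJ)
      refine ⟨trace M, Set.mem_iInter₂.2 fun γ hγ =>
        ⟨subset_closure ⟨M, _, _, rfl⟩, (instanceTrue_trace M _ _).2 ?_⟩⟩
      -- The two assignments of the empty set of variables agree.
      convert hM γ ⟨γ, hγ, rfl⟩
  rw [Set.mem_iInter] at hv
  have hvA : v ∈ closure (traces A) := (hv ⟨γ₀, hγ₀⟩).1
  refine ⟨NameModel hA hvA, hA.nonempty_name.map (NameModel.mk hA hvA), inferInstance,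
    fun γ hγ => ?_⟩
  convert (NameModel.realize_mk_iff hA hvA γ (hΓA γ hγ) Fin.elim0).2 (hv ⟨γ, hγ⟩).2

theorem mainTheorem4 (κ μ : Cardinal.{u}) (hμ : ℵ₀ ≤ μ) (hμκ : μ ≤ κ) :
    FinallyCompact (OmegaPower κ) μ ↔ OmegaOneLogicCompact κ μ :=
  ⟨omegaOneLogicCompact_of_finallyCompact (hμ.trans hμκ) (aleph0_pos.trans_le hμ),
    finallyCompact_of_omegaOneLogicCompact (hμ.trans hμκ)⟩
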